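/- **Theorem (Total energy conservation for the split DG schemes).** Let $L,V_c>0$, let $0=x_{1/2}<\dots<x_{N_x+1/2}=L$ and $-V_c=v_{1/2}<\dots<v_{N_v+1/2}=V_c$ be arbitrary meshes of $\Omega_x=[0,L]$ (with periodic boundary conditions) and $\Omega_v=[-V_c,V_c]$, with cells $K_{x,i}=[x_{i-1/2},x_{i+1/2}]$ and $K_{v,j}=[v_{j-1/2},v_{j+1/2}]$. Let $\mathcal W_h^k$ and $\mathcal Z_h^k$ be the spaces of piecewise polynomials of degree at most $k$ on the $x$-mesh and on the $v$-mesh (discontinuous across interfaces), and $\mathcal S_h^k$ the space of functions that on each $K_{x,i}\times K_{v,j}$ are polynomials of degree at most $k$ in each of $x$ and $v$. Let $x_i^{(l)}$, $v_j^{(m)}$ ($l,m=1,\dots,k+1$) be the $k+1$ Gauss–Legendre points of $K_{x,i}$ and $K_{v,j}$. For a constant speed $s$ and time step $\tau\neq0$, the midpoint DG discretization of $\partial_t w+s\,\partial_y w=0$ from $w_0$ to $w_1$ is: for every test function $\varphi$ in the piecewise polynomial space and every cell $K=[y_-,y_+]$, $$\int_K \frac{w_1-w_0}{\tau}\varphi\,dy-\int_K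 s\,\frac{w_0+w_1}{2}\,\varphi'\,dy+\widehat{s\bar w}(y_+)\,\varphi(y_+^-)-\widehat{s\bar w}(y_-)\,\varphi(y_-^+)=0,\qquad \bar w=\frac{w_0+w_1}{2}.$$ Here $\widehat{s w}$ is either the central flux $s\frac{w^-+w^+}{2}$ or the upwind flux $s\frac{w^-+w^+}{2}-\frac{|s|}{2}(w^+-w^-)$, where $w^-$ and $w^+$ are the left and right traces; if $\tau<0$ the upwind flux is replaced by the downwind flux $s\frac{w^-+w^+}{2}+\frac{|s|}{2}(w^+-w^-)$. In $x$ the traces are taken periodically. In $v$, where $f$ is taken to vanish for $|v|\ge V_c$, the flux at $v=\pm V_c$ is zero. The type of flux (central or upwind) may be chosen independently in the two algorithms below. *Scheme-a$(\tau)$* takes $(f,E)\in\mathcal S_h^k\times\mathcal W_h^k$ to $(f',E')\in\mathcal S_h^k\times\mathcal W_h^k$ with $E'=E$ and $f'(x_i^{(l)},v_j^{(m)})=g_j^{(m)}(x_i^{(l)})$ for all $i,j,l,m$, where $g_j^{(m)}\in\mathcal W_h^k$ satisfies the discretization above in $y=x$ with $s=v_j^{(m)}$, $w_0=f(\cdot,v_j^{(m)})$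 and $w_1=g_j^{(m)}$. *Scheme-b$(\tau)$* takes $(f,E)\in\mathcal S_h^k\times\mathcal W_h^k$ to $(f',E')\in\mathcal S_h^k\times\mathcal W_h^k$ with $f'(x_i^{(l)},v_j^{(m)})=g_i^{(l)}(v_j^{(m)})$ and $E'(x_i^{(l)})=E_i^{(l)}$ for all $i,j,l,m$, where $g_i^{(l)}\in\mathcal Z_h^k$ and $E_i^{(l)}\in\mathbb R$ satisfy the discretization above in $y=v$ with $s=\frac12\big(E(x_i^{(l)})+E_i^{(l)}\big)$, $w_0=f(x_i^{(l)},\cdot)$, $w_1=g_i^{(l)}$, together with $$\frac{E_i^{(l)}-E(x_i^{(l)})}{\tau}=-\frac12\Big(\int_{\Omega_v} f(x_i^{(l)},v)\,v\,dv+\int_{\Omega_v} g_i^{(l)}(v)\,v\,dv\Big).$$ For $\Delta t>0$ put $$\text{Scheme-4}(\Delta t)=\text{Scheme-a}(\Delta t/2)\,\text{Scheme-b}(\Delta t)\,\text{Scheme-a}(\Delta t/2),$$ $$\text{Scheme-4F}(\Delta t)=\text{Scheme-4}(\beta_1\Delta t)\,\text{Scheme-4}(\beta_2\Delta t)\,\text{Scheme-4}(\beta_3\Delta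 t),$$ where $\beta_1=\beta_3=(2+2^{1/3}+2^{-1/3})/3$, $\beta_2=1-2\beta_1$, and Scheme-4$(\tau)$ is defined by the same formula for $\tau<0$. If $k\ge2$, then whenever $(f_h^{n+1},E_h^{n+1})$ is obtained from $(f_h^n,E_h^n)\in\mathcal S_h^k\times\mathcal W_h^k$ by one step of Scheme-4$(\Delta t)$, or by one step of Scheme-4F$(\Delta t)$, the discrete total energy is conserved exactly: $TE_{n+1}=TE_n$, where $$2\,TE_n=\int_{\Omega_x}\int_{\Omega_v} f_h^n\,|v|^2\,dv\,dx+\int_{\Omega_x}|E_h^n|^2\,dx.$$ -/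

import Mathlib

noncomputable section

namespace VlasovAmpere

open Polynomial

/-! ### Gauss quadrature points -/

/-- The Legendre polynomial of degree `n`, transported from `[-1, 1]` to `[0, 1]`. -/
def legendre (n : ℕ) : ℝ[X] := (shiftedLegendre n).map (Int.castRingHom ℝ)

/-- The Legendre polynomial of degree `n` has exactly `n` distinct real roots. -/
theorem card_roots_legendre (n : ℕ) : (legendre n).roots.toFinset.card = n := by
  have hdeg : (legendre n).natDegree = n := by
    rw [legendre, natDegree_map_eq_of_injective Int.cast_injective, natDegree_shiftedLegendre]
  refine le_antisymm ((Multiset.toFinset_card_le _).trans ((card_roots' _).trans hdeg.le)) ?_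
  rcases Nat.eq_zero_or_pos n with rfl | hn
  · exact Nat.zero_le _
  set q : ℝ[X] := X ^ n * (1 - X) ^ n with hq
  -- Rodrigues' formula
  have hrod : derivative^[n] q = C (n.factorial : ℝ) * legendre n := by
    have h := congrArg (Polynomial.map (Int.castRingHom ℝ)) (factorial_mul_shiftedLegendre_eq n)
    rw [← iterate_derivative_map] at h
    simpa [legendre, hq] using h.symm
  have hfac : (n.factorial : ℝ) ≠ 0 := by exact_mod_cast n.factorial_ne_zero
  have hroots : (derivative^[n] q).roots = (legendre n).roots := by
    rw [hrod, roots_C_mul _ hfac]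
  have hlast : derivative^[n] q ≠ 0 := by
    rw [hrod]
    refine mul_ne_zero (C_ne_zero.2 hfac) fun h => ?_
    rw [h] at hdeg
    simp at hdeg
    omega
  have hne : ∀ m ≤ n, derivative^[m] q ≠ 0 := fun m hm h => hlast <| by
    obtain ⟨d, rfl⟩ := Nat.exists_eq_add_of_le' hm
    rw [Function.iterate_add_apply, h, iterate_derivative_zero]
  -- the endpoints `0` and `1` stay roots of the first `n - 1` derivatives
  have hends : ∀ m < n, ({0, 1} : Finset ℝ) ⊆ (derivative^[m] q).roots.toFinset := by
    intro m hm x hx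
    rw [Multiset.mem_toFinset, mem_roots (hne m hm.le)]
    have hdvd : (X * (1 - X) : ℝ[X]) ∣ derivative^[m] q := by
      rw [hq, ← mul_pow]
      exact (dvd_pow_self _ (by omega)).trans (pow_sub_dvd_iterate_derivative_pow _ n m)
    refine IsRoot.dvd ?_ hdvd
    rcases Finset.mem_insert.1 hx with rfl | hx
    · simp
    · rw [Finset.mem_singleton.1 hx]
      simp
  have hcard : ∀ m < n, m + 2 ≤ (derivative^[m] q).roots.toFinset.card := by
    intro m
    induction m with
    | zero =>
      intro hm
      simpa using Finset.card_le_card (hends 0 hm)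
    | succ m ih =>
      intro hm
      have h1 := ih (by omega)
      have h2 := card_roots_toFinset_le_card_roots_derivative_sdiff_roots_succ (derivative^[m] q)
      rw [← Function.iterate_succ_apply' derivative m q, Nat.succ_eq_add_one] at h2
      have h3 : Disjoint ((derivative^[m + 1] q).roots.toFinset \
          (derivative^[m] q).roots.toFinset) {0, 1} :=
        Finset.disjoint_left.2 fun x hx hx' =>
          (Finset.mem_sdiff.1 hx).2 (hends m (by omega) hx')
      have h4 := Finset.card_le_card (Finset.union_subset
        (Finset.sdiff_subset (s := (derivative^[m + 1] q).roots.toFinset)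
          (t := (derivative^[m] q).roots.toFinset)) (hends (m + 1) hm))
      rw [Finset.card_union_of_disjoint h3] at h4
      have h5 : ({0, 1} : Finset ℝ).card = 2 := by simp
      omega
  obtain ⟨m, rfl⟩ : ∃ m, n = m + 1 := ⟨n - 1, by omega⟩
  have h1 := hcard m (by omega)
  have h2 := card_roots_toFinset_le_derivative (derivative^[m] q)
  rw [← Function.iterate_succ_apply' derivative m q, hroots] at h2
  omega

/-- The `n` Gauss points of the reference interval `[0, 1]`, in increasing order: the roots of the
Legendre polynomial of degree `n`. -/
def gaussPoint (n : ℕ) : Fin n ↪o ℝ :=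
  (legendre n).roots.toFinset.orderEmbOfFin (card_roots_legendre n)

/-! ### Meshes and piecewise polynomials -/

/-- A mesh `a = y_{1/2} < y_{3/2} < ⋯ < y_{N+1/2} = b` of `[a, b]`, with `N = T.n` cells. -/
structure Mesh (a b : ℝ) where
  n : ℕ
  node : Fin (n + 1) → ℝ
  strictMono : StrictMono node
  node_zero : node 0 = a
  node_last : node (Fin.last n) = b

namespace Mesh

variable {a b : ℝ} (T : Mesh a b)

/-- Left end of the cell `i`. -/
def left (i : Fin T.n) : ℝ := T.node i.castSucc

/-- Right end of the cell `i`. -/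
def right (i : Fin T.n) : ℝ := T.node i.succ

/-- The `l`-th of the `k + 1` Gauss points of the cell `i`. -/
def gauss (k : ℕ) (i : Fin T.n) (l : Fin (k + 1)) : ℝ :=
  T.left i + (T.right i - T.left i) * gaussPoint (k + 1) l

/-- The piecewise polynomials of degree at most `k` on the mesh, one polynomial for each cell and no
continuity across cell interfaces (the spaces `𝒲_h^k` on the `x`-mesh and `𝒵_h^k` on the
`v`-mesh). -/
def polySpace (k : ℕ) : Submodule ℝ (Fin T.n → ℝ[X]) :=
  Submodule.pi Set.univ fun _ => degreeLE ℝ (k : WithBot ℕ)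

/-- The function on the line given by a piecewise polynomial (zero on the null set of the mesh
nodes, and outside `[a, b]`). -/
def toFun (w : Fin T.n → ℝ[X]) (y : ℝ) : ℝ :=
  ∑ i, (Set.Ioo (T.left i) (T.right i)).indicator (fun z => (w i).eval z) y

end Mesh

/-- The space `𝒮_h^k`: on each cell `K_{i,j}` a polynomial in `x` and `v` of degree at most `k` in
each of the variables. In `ℝ[X][X]` the inner variable is `x`, the outer variable is `v`. -/
def tensorSpace {a b c d : ℝ} (Tx : Mesh a b) (Tv : Mesh c d) (k : ℕ) :
    Set (Fin Tx.n → Fin Tv.n → ℝ[X][X]) :=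
  {f | ∀ i j, (f i j).natDegree ≤ k ∧ ∀ m, ((f i j).coeff m).natDegree ≤ k}

/-- The function of `(x, v)` given by a family of polynomials on the cells `K_{i,j}`. -/
def tensorToFun {a b c d : ℝ} (Tx : Mesh a b) (Tv : Mesh c d)
    (f : Fin Tx.n → Fin Tv.n → ℝ[X][X]) (x v : ℝ) : ℝ :=
  ∑ i, ∑ j, (Set.Ioo (Tx.left i) (Tx.right i) ×ˢ Set.Ioo (Tv.left j) (Tv.right j)).indicator
    (fun z => (f i j).evalEval z.1 z.2) (x, v)

/-- For fixed `v`, the piecewise polynomial `x ↦ f(x, v)` on the row of cells `j`. -/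
def sliceV {M N : ℕ} (f : Fin M → Fin N → ℝ[X][X]) (j : Fin N) (v : ℝ) : Fin M → ℝ[X] :=
  fun i => (f i j).eval (C v)

/-- For fixed `x`, the piecewise polynomial `v ↦ f(x, v)` on the column of cells `i`. -/
def sliceX {M N : ℕ} (f : Fin M → Fin N → ℝ[X][X]) (i : Fin M) (x : ℝ) : Fin N → ℝ[X] :=
  fun j => (f i j).map (evalRingHom x)

/-! ### Numerical fluxes -/

/-- The two choices of numerical flux. -/
inductive Flux
  | central
  | upwind

/-- The numerical flux for `a w` at an interface with left trace `wl` and right trace `wr`. For a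
negative time step, upwinding is reversed (downwind flux). -/
def numFlux (Φ : Flux) (dt a wl wr : ℝ) : ℝ :=
  match Φ with
  | .central => a * ((wl + wr) / 2)
  | .upwind =>
    if 0 < dt then a * ((wl + wr) / 2) - |a| / 2 * (wr - wl)
    else a * ((wl + wr) / 2) + |a| / 2 * (wr - wl)

section Fluxes

variable {a b : ℝ} (T : Mesh a b) (Φ : Flux) (dt s : ℝ)

/-- The flux with speed `s` through the right end of the cell `i` under periodic boundary
conditions; `finRotate` sends a cell to its right neighbour, and the last cell to the first. -/
def periodicFlux (w : Fin T.n → ℝ[X]) (i : Fin T.n) : ℝ :=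
  numFlux Φ dt s ((w i).eval (T.right i))
    ((w (finRotate T.n i)).eval (T.left (finRotate T.n i)))

/-- The flux with speed `s` through the interface `r` when the function vanishes at the ends of the
interval: the numerical flux at an interior interface, zero at the two end points. -/
def zeroBoundaryFlux (w : Fin T.n → ℝ[X]) (r : Fin (T.n + 1)) : ℝ :=
  if h : 0 < r.val ∧ r.val < T.n then
    numFlux Φ dt s ((w ⟨r.val - 1, by omega⟩).eval (T.node r)) ((w ⟨r.val, h.2⟩).eval (T.node r))
  else 0

/-- The left-hand side, on the cell `i`, of the discontinuous Galerkin discretization of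
`∂ₜ w + s ∂_y w = 0` by the implicit midpoint rule, from `w₀` to `w₁` with time step `dt` and test
function `φ`; `Fr` and `Fl` are the numerical fluxes of `s (w₀ + w₁) / 2` through the right and left
ends of the cell. -/
def cellForm (w₀ w₁ φ : Fin T.n → ℝ[X]) (i : Fin T.n) (Fr Fl : ℝ) : ℝ :=
  (∫ y in T.left i..T.right i, ((w₁ i).eval y - (w₀ i).eval y) / dt * (φ i).eval y)
    - (∫ y in T.left i..T.right i,
        s * (((w₁ i).eval y + (w₀ i).eval y) / 2) * (derivative (φ i)).eval y)
    + Fr * (φ i).eval (T.right i) - Fl * (φ i).eval (T.left i)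

end Fluxes

/-! ### The schemes -/

/-- A numerical state: `f_h` in `𝒮_h^k` and `E_h` in `𝒲_h^k`. -/
structure State {a b c d : ℝ} (Tx : Mesh a b) (Tv : Mesh c d) (k : ℕ) where
  f : Fin Tx.n → Fin Tv.n → ℝ[X][X]
  E : Fin Tx.n → ℝ[X]
  f_mem : f ∈ tensorSpace Tx Tv k
  E_mem : E ∈ Tx.polySpace k

section Schemes

variable {L Vc : ℝ} {Tx : Mesh 0 L} {Tv : Mesh (-Vc) Vc} {k : ℕ}

/-- Scheme-a with time step `dt` takes `u` to `u'`. For each Gauss point `v_j^{(m)}`, `g j m` solves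
the discretization of `∂ₜ f + v_j^{(m)} ∂ₓ f = 0`, periodic in `x`. -/
def SchemeA (Φ : Flux) (dt : ℝ) (u u' : State Tx Tv k) : Prop :=
  ∃ g : Fin Tv.n → Fin (k + 1) → Fin Tx.n → ℝ[X],
    (∀ j m, g j m ∈ Tx.polySpace k) ∧
    (∀ j m, ∀ φ ∈ Tx.polySpace k, ∀ i,
      let v := Tv.gauss k j m
      let w₀ := sliceV u.f j v
      let w := (1 / 2 : ℝ) • (g j m + w₀)
      cellForm Tx dt v w₀ (g j m) φ i (periodicFlux Tx Φ dt v w i)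
        (periodicFlux Tx Φ dt v w ((finRotate Tx.n).symm i)) = 0) ∧
    (∀ i j l m, (u'.f i j).evalEval (Tx.gauss k i l) (Tv.gauss k j m)
      = (g j m i).eval (Tx.gauss k i l)) ∧
    u'.E = u.E

/-- The current density `∫_{-V_c}^{V_c} w(v) v dv` of a piecewise polynomial `w` on the
`v`-mesh. -/
def current (Tv : Mesh (-Vc) Vc) (w : Fin Tv.n → ℝ[X]) : ℝ :=
  ∫ v in -Vc..Vc, Tv.toFun w v * v

/-- Scheme-b with time step `dt` takes `u` to `u'`. For each Gauss point `x_i^{(l)}`, the function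
`g i l` and the number `e i l` solve the coupled discretization of `∂ₜ f + E ∂ᵥ f = 0`,
`∂ₜ E = -J`. Since `f` is taken to vanish for `|v| ≥ V_c`, the numerical flux
through `v = ± V_c` is zero. -/
def SchemeB (Φ : Flux) (dt : ℝ) (u u' : State Tx Tv k) : Prop :=
  ∃ (g : Fin Tx.n → Fin (k + 1) → Fin Tv.n → ℝ[X]) (e : Fin Tx.n → Fin (k + 1) → ℝ),
    (∀ i l, g i l ∈ Tv.polySpace k) ∧
    (∀ i l, ∀ φ ∈ Tv.polySpace k, ∀ j,
      let x := Tx.gauss k i l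
      let w₀ := sliceX u.f i x
      let w := (1 / 2 : ℝ) • (g i l + w₀)
      let s := ((u.E i).eval x + e i l) / 2
      cellForm Tv dt s w₀ (g i l) φ j (zeroBoundaryFlux Tv Φ dt s w j.succ)
        (zeroBoundaryFlux Tv Φ dt s w j.castSucc) = 0) ∧
    (∀ i l,
      let x := Tx.gauss k i l
      (e i l - (u.E i).eval x) / dt
        = -(1 / 2) * (current Tv (sliceX u.f i x) + current Tv (g i l))) ∧
    (∀ i j l m, (u'.f i j).evalEval (Tx.gauss k i l) (Tv.gauss k j m)
      = (g i l j).eval (Tv.gauss k j m)) ∧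
    (∀ i l, (u'.E i).eval (Tx.gauss k i l) = e i l)

/-- Scheme-4: Strang splitting, with flux `Φa` in the Scheme-a steps and `Φb` in the Scheme-b
step. -/
def Scheme4 (Φa Φb : Flux) (dt : ℝ) (u u' : State Tx Tv k) : Prop :=
  ∃ u₁ u₂ : State Tx Tv k,
    SchemeA Φa (dt / 2) u u₁ ∧ SchemeB Φb dt u₁ u₂ ∧ SchemeA Φa (dt / 2) u₂ u'

/-- `β₁ = β₃ = (2 + 2^{1/3} + 2^{-1/3}) / 3`. -/
def β₁ : ℝ := (2 + (2 : ℝ) ^ (1 / 3 : ℝ) + (2 : ℝ) ^ (-(1 / 3) : ℝ)) / 3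

/-- `β₂ = 1 - 2 β₁`. -/
def β₂ : ℝ := 1 - 2 * β₁

/-- Scheme-4F: the fourth-order composition of three Scheme-4 steps of lengths `β₁ Δt`, `β₂ Δt`,
`β₁ Δt`. -/
def Scheme4F (Φa Φb : Flux) (dt : ℝ) (u u' : State Tx Tv k) : Prop :=
  ∃ u₁ u₂ : State Tx Tv k,
    Scheme4 Φa Φb (β₁ * dt) u u₁ ∧ Scheme4 Φa Φb (β₂ * dt) u₁ u₂ ∧ Scheme4 Φa Φb (β₁ * dt) u₂ u'

/-- The total energy `TE`, with
`2 TE = ∫_{Ω_x} ∫_{Ω_v} f_h |v|² dv dx + ∫_{Ω_x} |E_h|² dx`. -/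
def totalEnergy (u : State Tx Tv k) : ℝ :=
  1 / 2 * ((∫ x in (0)..L, ∫ v in -Vc..Vc, tensorToFun Tx Tv u.f x v * |v| ^ 2)
    + ∫ x in (0)..L, |Tx.toFun u.E x| ^ 2)

end Schemes

end VlasovAmpere

end

namespace VlasovAmpere

open Polynomial

/-! ### Gauss quadrature -/

/-! The energy sees only nodal values. On each cell the kinetic integrand has degree at most `k` in
`x` and `k + 2` in `v`, and `E ^ 2` has degree at most `2 * k`, so Gauss quadrature with `k + 1`
points, exact up to degree `2 * k + 1`, computes both integrals (`two_mul_totalEnergy`). The schemes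
prescribe exactly these nodal values, so it suffices to follow the one-dimensional solutions at the
Gauss points.

In Scheme-a the test function `1` shows that the mass in `x` is conserved at every Gauss velocity,
hence so is its sum weighted by `v ^ 2`, while `E` is unchanged. In Scheme-b the test function `v ^
2`, admissible because `2 ≤ k`, gives a kinetic gain `dt * s * (J₀ + J₁)` at every Gauss point in
`x`, where `J₀` and `J₁` are the old and new currents. As `s` is the mean of the old and new fields,
the discrete Ampère law times their sum gives the same loss in `E ^ 2`.

The shape of the flux plays no role: it only has to be single-valued at interfaces, so that it
cancels in the sum over cells, and zero at `v = ± Vc`. Both balances hold for every nonzero time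
step, so they survive composition, including the negative substep of Scheme-4F. -/

theorem natDegree_legendre (n : ℕ) : (legendre n).natDegree = n := by
  rw [legendre, natDegree_map_eq_of_injective Int.cast_injective, natDegree_shiftedLegendre]

/-- The constant coefficient is `1`. The degree alone would not settle the case `n = 0`. -/
theorem legendre_ne_zero (n : ℕ) : legendre n ≠ 0 := by
  rw [legendre, Polynomial.map_ne_zero_iff Int.cast_injective]
  intro h
  have h3 := coeff_shiftedLegendre n 0
  rw [h] at h3
  simp at h3

theorem iterate_derivative_rodrigues (n : ℕ) :
    derivative^[n] (X ^ n * (1 - X) ^ n : ℝ[X]) = C (n.factorial : ℝ) * legendre n := by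
  have h := congrArg (Polynomial.map (Int.castRingHom ℝ)) (factorial_mul_shiftedLegendre_eq n)
  rw [← iterate_derivative_map] at h
  simpa [legendre] using h.symm

theorem eval_iterate_derivative_rodrigues {m n : ℕ} (hm : m < n) {x : ℝ} (hx : x = 0 ∨ x = 1) :
    (derivative^[m] (X ^ n * (1 - X) ^ n : ℝ[X])).eval x = 0 := by
  have hdvd : (X * (1 - X) : ℝ[X]) ∣ derivative^[m] (X ^ n * (1 - X) ^ n : ℝ[X]) := by
    rw [← mul_pow]
    exact (dvd_pow_self _ (by omega)).trans (pow_sub_dvd_iterate_derivative_pow _ n m)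
  refine IsRoot.dvd ?_ hdvd
  rcases hx with rfl | rfl <;> simp

theorem intervalIntegrable_eval_mul_eval (p q : ℝ[X]) (c d : ℝ) :
    IntervalIntegrable (fun x => p.eval x * q.eval x) MeasureTheory.volume c d :=
  (p.continuous.mul q.continuous).intervalIntegrable c d

/-- Repeated integration by parts against derivatives of `X ^ n * (1 - X) ^ n`. -/
theorem integral_iterate_derivative_rodrigues_mul {n : ℕ} (m : ℕ) (hm : m ≤ n) (q : ℝ[X])
    (hq : derivative^[m] q = 0) :
    ∫ x in (0 : ℝ)..1, (derivative^[m] (X ^ n * (1 - X) ^ n : ℝ[X])).eval x * q.eval x = 0 := by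
  induction m generalizing q with
  | zero =>
    have : q = 0 := hq
    simp [this]
  | succ m ih =>
    have h := intervalIntegral.integral_deriv_mul_eq_sub (a := 0) (b := 1)
      (fun x _ => Polynomial.hasDerivAt (derivative^[m] (X ^ n * (1 - X) ^ n : ℝ[X])) x)
      (fun x _ => Polynomial.hasDerivAt q x)
      ((Polynomial.continuous _).intervalIntegrable _ _)
      ((Polynomial.continuous _).intervalIntegrable _ _)
    -- Each integration by parts moves one derivative onto `q`. The boundary terms vanish because
    -- fewer than `n` derivatives leave the zeros at `0` and `1`.
    rw [intervalIntegral.integral_add (intervalIntegrable_eval_mul_eval _ _ _ _)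
      (intervalIntegrable_eval_mul_eval _ _ _ _),
      ih (by omega) (derivative q) (by rwa [← Function.iterate_succ_apply]),
      eval_iterate_derivative_rodrigues (by omega) (Or.inl rfl),
      eval_iterate_derivative_rodrigues (by omega) (Or.inr rfl)] at h
    simpa [Function.iterate_succ_apply'] using h

/-- Rodrigues' formula and `n` integrations by parts: the `n`-th derivative of `q` is zero. -/
theorem integral_legendre_mul {n : ℕ} (q : ℝ[X]) (hq : q.degree < n) :
    ∫ x in (0 : ℝ)..1, (legendre n).eval x * q.eval x = 0 := by
  have h := integral_iterate_derivative_rodrigues_mul n le_rfl q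
    (iterate_derivative_eq_zero_of_degree_lt hq)
  have hfac : (n.factorial : ℝ) ≠ 0 := by exact_mod_cast n.factorial_ne_zero
  simp only [iterate_derivative_rodrigues, eval_mul, eval_C, mul_assoc,
    intervalIntegral.integral_const_mul] at h
  exact (mul_eq_zero.1 h).resolve_left hfac

theorem eval_legendre_gaussPoint (n : ℕ) (l : Fin n) : (legendre n).eval (gaussPoint n l) = 0 := by
  have h := Finset.orderEmbOfFin_mem (legendre n).roots.toFinset (card_roots_legendre n) l
  exact (mem_roots'.1 (Multiset.mem_toFinset.1 h)).2

/-- The weights of Gauss quadrature with `n` points on `[0, 1]`. -/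
noncomputable def gaussWeight (n : ℕ) (l : Fin n) : ℝ :=
  ∫ x in (0 : ℝ)..1, (Lagrange.basis Finset.univ (gaussPoint n) l).eval x

/-- Gauss quadrature with `n` points is exact for polynomials of degree less than `2 n`. -/
theorem integral_eq_sum_gaussWeight {n : ℕ} {p : ℝ[X]} (hp : p.natDegree < 2 * n) :
    ∫ x in (0 : ℝ)..1, p.eval x = ∑ l, gaussWeight n l * p.eval (gaussPoint n l) := by
  have hL := legendre_ne_zero n
  have hdeg : (legendre n).degree = n := by
    rw [degree_eq_natDegree hL, natDegree_legendre]
  -- Divide `p` by the Legendre polynomial. The quotient has degree below `n`, so its product with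
  -- `legendre n` integrates to zero; that product also vanishes at the Gauss points, so only the
  -- remainder counts, and it equals its interpolant there.
  have hr : (p % legendre n).degree < n := hdeg ▸ degree_mod_lt p hL
  have hq : (p / legendre n).degree < n := by
    by_cases h : p / legendre n = 0
    · rw [h, degree_zero]
      exact WithBot.bot_lt_coe n
    have hle : (legendre n).degree ≤ p.degree := by
      by_contra hlt
      exact h ((Polynomial.div_eq_zero_iff hL).2 (not_le.1 hlt))
    have hp0 : p ≠ 0 := fun h0 => h (by rw [h0, EuclideanDomain.zero_div])
    have hsum := degree_add_div hL hle
    rw [hdeg, degree_eq_natDegree h, degree_eq_natDegree hp0] at hsum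
    rw [degree_eq_natDegree h]
    norm_cast at hsum ⊢
    omega
  have hsplit : ∀ x, p.eval x = (legendre n).eval x * (p / legendre n).eval x
      + (p % legendre n).eval x := fun x => by
    rw [← eval_mul, ← eval_add, EuclideanDomain.div_add_mod]
  have hint : p % legendre n = Lagrange.interpolate Finset.univ (gaussPoint n)
      fun l => (p % legendre n).eval (gaussPoint n l) :=
    Lagrange.eq_interpolate (gaussPoint n).injective.injOn (by simpa using hr)
  have hnode : ∀ l, (p % legendre n).eval (gaussPoint n l) = p.eval (gaussPoint n l) := fun l => by
    rw [hsplit, eval_legendre_gaussPoint, zero_mul, zero_add]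
  simp only [hnode] at hint
  rw [intervalIntegral.integral_congr (fun x _ => hsplit x), intervalIntegral.integral_add
    (intervalIntegrable_eval_mul_eval _ _ _ _)
    ((Polynomial.continuous _).intervalIntegrable _ _), integral_legendre_mul _ hq, zero_add, hint]
  simp only [Lagrange.interpolate_apply, eval_finsetSum, eval_mul, eval_C]
  rw [intervalIntegral.integral_finsetSum fun l _ =>
    ((Polynomial.continuous _).intervalIntegrable _ _).const_mul _]
  refine Finset.sum_congr rfl fun l _ => ?_
  rw [intervalIntegral.integral_const_mul, gaussWeight, mul_comm]

/-! ### Quadrature, integration and piecewise polynomials on a mesh -/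

namespace Mesh

variable {a b : ℝ} (T : Mesh a b)

theorem left_lt_right (i : Fin T.n) : T.left i < T.right i :=
  T.strictMono i.castSucc_lt_succ

/-- The quadrature weight attached to `T.gauss k i l`. -/
noncomputable def weight (k : ℕ) (i : Fin T.n) (l : Fin (k + 1)) : ℝ :=
  (T.right i - T.left i) * gaussWeight (k + 1) l

theorem integral_eq_sum_weight {k : ℕ} (i : Fin T.n) {p : ℝ[X]} (hp : p.natDegree ≤ 2 * k + 1) :
    ∫ y in T.left i..T.right i, p.eval y = ∑ l, T.weight k i l * p.eval (T.gauss k i l) := by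
  have hne : T.right i - T.left i ≠ 0 := (sub_pos.2 (T.left_lt_right i)).ne'
  have hdeg : (p.comp (C (T.right i - T.left i) * X + C (T.left i))).natDegree < 2 * (k + 1) := by
    refine (natDegree_comp_le.trans (Nat.mul_le_mul_left _ natDegree_linear_le)).trans_lt ?_
    omega
  have h := integral_eq_sum_gaussWeight hdeg
  have h2 := intervalIntegral.integral_comp_mul_add (a := 0) (b := 1) (fun y => p.eval y) hne
    (T.left i)
  simp only [eval_comp, eval_add, eval_mul, eval_C, eval_X] at h
  rw [h, mul_zero, mul_one, zero_add, sub_add_cancel, smul_eq_mul, eq_comm,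
    inv_mul_eq_iff_eq_mul₀ hne] at h2
  rw [h2, Finset.mul_sum]
  refine Finset.sum_congr rfl fun l _ => ?_
  rw [weight, gauss, mul_assoc, add_comm (T.left i)]

/-- An integral over the whole interval splits into the integrals over the cells. -/
theorem integral_eq_sum {F : ℝ → ℝ} {P : Fin T.n → ℝ → ℝ} (hP : ∀ i, Continuous (P i))
    (hF : ∀ i, ∀ y ∈ Set.Ioo (T.left i) (T.right i), F y = P i y) :
    ∫ y in a..b, F y = ∑ i, ∫ y in T.left i..T.right i, P i y := by
  -- Agreement on open cells is enough, since the nodes form a null set.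
  have hEq : ∀ i, Set.EqOn (P i) F (Set.uIoo (T.left i) (T.right i)) := fun i y hy => by
    rw [Set.uIoo_of_le (T.left_lt_right i).le] at hy
    exact (hF i y hy).symm
  -- The nodes reindexed by `ℕ`; the default value `0` beyond the last node is never reached.
  let c : ℕ → ℝ := fun r => if h : r < T.n + 1 then T.node ⟨r, h⟩ else 0
  have hl : ∀ i : Fin T.n, c i = T.left i := fun i => by
    simp only [c, left]
    rw [dif_pos (by omega)]
    rfl
  have hr : ∀ i : Fin T.n, c (i + 1) = T.right i := fun i => by
    simp only [c, right]
    rw [dif_pos (by omega)]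
    rfl
  have h := intervalIntegral.sum_integral_adjacent_intervals (f := F) (a := c) (n := T.n)
    (μ := MeasureTheory.volume) fun r hr' => by
      have h1 := hl ⟨r, hr'⟩
      have h2 := hr ⟨r, hr'⟩
      simp only at h1 h2
      rw [h1, h2]
      exact ((hP _).intervalIntegrable _ _).congr_uIoo (hEq _)
  have h0 : c 0 = a := by
    rw [← T.node_zero]
    simp [c]
  have hn : c T.n = b := by
    refine Eq.trans ?_ T.node_last
    simp [c, Fin.last]
  rw [h0, hn, Finset.sum_range] at h
  rw [← h]
  refine Finset.sum_congr rfl fun i _ => ?_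
  rw [hl, hr]
  exact (intervalIntegral.integral_congr_uIoo (hEq i)).symm

theorem eq_of_mem_Ioo {i i' : Fin T.n} {y : ℝ} (h : y ∈ Set.Ioo (T.left i) (T.right i))
    (h' : y ∈ Set.Ioo (T.left i') (T.right i')) : i = i' := by
  have key : ∀ {i i' : Fin T.n}, y ∈ Set.Ioo (T.left i) (T.right i) →
      y ∈ Set.Ioo (T.left i') (T.right i') → ¬ i < i' := fun {i i'} h h' hlt =>
    absurd (h'.1.trans h.2) (not_lt.2 (T.strictMono.monotone (Fin.succ_le_castSucc_iff.2 hlt)))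
  exact le_antisymm (not_lt.1 (key h' h)) (not_lt.1 (key h h'))

theorem toFun_of_mem {i : Fin T.n} {y : ℝ} (w : Fin T.n → ℝ[X])
    (h : y ∈ Set.Ioo (T.left i) (T.right i)) : T.toFun w y = (w i).eval y := by
  rw [toFun, Finset.sum_eq_single i, Set.indicator_of_mem h]
  · exact fun i' _ hne => Set.indicator_of_notMem (fun h' => hne (T.eq_of_mem_Ioo h' h)) _
  · simp

theorem natDegree_le_of_mem_polySpace {k : ℕ} {w : Fin T.n → ℝ[X]} (hw : w ∈ T.polySpace k)
    (i : Fin T.n) : (w i).natDegree ≤ k :=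
  natDegree_le_iff_degree_le.2 (mem_degreeLE.1 (hw i (Set.mem_univ i)))

theorem mem_polySpace {k : ℕ} {w : Fin T.n → ℝ[X]} (hw : ∀ i, (w i).natDegree ≤ k) :
    w ∈ T.polySpace k :=
  fun i _ => mem_degreeLE.2 (natDegree_le_iff_degree_le.1 (hw i))

end Mesh

theorem tensorToFun_of_mem {a b c d : ℝ} (Tx : Mesh a b) (Tv : Mesh c d)
    (f : Fin Tx.n → Fin Tv.n → ℝ[X][X]) {i : Fin Tx.n} {j : Fin Tv.n} {x v : ℝ}
    (hx : x ∈ Set.Ioo (Tx.left i) (Tx.right i)) (hv : v ∈ Set.Ioo (Tv.left j) (Tv.right j)) :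
    tensorToFun Tx Tv f x v = (f i j).evalEval x v := by
  rw [tensorToFun, Finset.sum_eq_single i, Finset.sum_eq_single j, Set.indicator_of_mem]
  · exact ⟨hx, hv⟩
  · exact fun j' _ hne =>
      Set.indicator_of_notMem (fun h => hne (Tv.eq_of_mem_Ioo (Set.mem_prod.1 h).2 hv)) _
  · simp
  · exact fun i' _ hne => Finset.sum_eq_zero fun j' _ =>
      Set.indicator_of_notMem (fun h => hne (Tx.eq_of_mem_Ioo (Set.mem_prod.1 h).1 hx)) _
  · simp

theorem eval_map_evalRingHom (p : ℝ[X][X]) (x v : ℝ) :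
    (p.map (evalRingHom x)).eval v = p.evalEval x v := by
  have h := eval_map_apply (f := evalRingHom x) (p := p) (C v)
  simpa using h

section TensorSpace

variable {a b c d : ℝ} {Tx : Mesh a b} {Tv : Mesh c d} {k : ℕ}
  {f : Fin Tx.n → Fin Tv.n → ℝ[X][X]}

theorem natDegree_sliceV_le (hf : f ∈ tensorSpace Tx Tv k) (j : Fin Tv.n) (v : ℝ)
    (i : Fin Tx.n) : (sliceV f j v i).natDegree ≤ k := by
  rw [sliceV, eval_eq_sum_range]
  refine natDegree_sum_le_of_forall_le _ _ fun m _ => ?_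
  rw [← C_pow]
  exact (natDegree_mul_C_le _ _).trans ((hf i j).2 m)

theorem natDegree_sliceX_le (hf : f ∈ tensorSpace Tx Tv k) (i : Fin Tx.n) (x : ℝ)
    (j : Fin Tv.n) : (sliceX f i x j).natDegree ≤ k :=
  natDegree_map_le.trans (hf i j).1

end TensorSpace

/-! ### The discrete total energy -/

section Schemes

variable {L Vc : ℝ} {Tx : Mesh 0 L} {Tv : Mesh (-Vc) Vc} {k : ℕ}

/-- The kinetic energy of a piecewise polynomial in `v` by quadrature. -/
theorem sum_integral_mul_sq (hk : 1 ≤ k) {w : Fin Tv.n → ℝ[X]} (hw : ∀ j, (w j).natDegree ≤ k) :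
    ∑ j, ∫ v in Tv.left j..Tv.right j, (w j).eval v * v ^ 2
      = ∑ j, ∑ m, Tv.weight k j m * ((w j).eval (Tv.gauss k j m) * Tv.gauss k j m ^ 2) := by
  refine Finset.sum_congr rfl fun j _ => ?_
  -- The bound `k + 2 ≤ 2 * k + 1` is where `1 ≤ k` enters.
  have hdeg : (w j * X ^ 2).natDegree ≤ 2 * k + 1 := by
    refine natDegree_mul_le.trans ?_
    rw [natDegree_X_pow]
    have := hw j
    omega
  simpa using Tv.integral_eq_sum_weight j hdeg

/-- Gauss quadrature evaluates the total energy exactly. -/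
theorem two_mul_totalEnergy (hk : 1 ≤ k) (u : State Tx Tv k) :
    2 * totalEnergy u = ∑ i, ∑ l, Tx.weight k i l *
      ((∑ j, ∑ m, Tv.weight k j m *
        ((u.f i j).evalEval (Tx.gauss k i l) (Tv.gauss k j m) * Tv.gauss k j m ^ 2))
        + (u.E i).eval (Tx.gauss k i l) ^ 2) := by
  -- The inner integral over `v`, already replaced by its quadrature sum, is a polynomial in `x` of
  -- degree at most `k` on each cell.
  let P : Fin Tx.n → ℝ[X] := fun i => ∑ j, ∑ m,
    C (Tv.weight k j m * Tv.gauss k j m ^ 2) * sliceV u.f j (Tv.gauss k j m) i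
  have hPeval : ∀ i x, (P i).eval x = ∑ j, ∑ m, Tv.weight k j m *
      ((u.f i j).evalEval x (Tv.gauss k j m) * Tv.gauss k j m ^ 2) := fun i x => by
    simp only [P, eval_finsetSum, eval_mul, eval_C, sliceV]
    refine Finset.sum_congr rfl fun j _ => Finset.sum_congr rfl fun m _ => ?_
    ring
  have hPdeg : ∀ i, (P i).natDegree ≤ 2 * k + 1 := fun i =>
    natDegree_sum_le_of_forall_le _ _ fun j _ => natDegree_sum_le_of_forall_le _ _ fun m _ =>
      (natDegree_C_mul_le _ _).trans ((natDegree_sliceV_le u.f_mem _ _ _).trans (by omega))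
  have hkin : ∫ x in (0)..L, ∫ v in -Vc..Vc, tensorToFun Tx Tv u.f x v * |v| ^ 2
      = ∑ i, ∫ x in Tx.left i..Tx.right i, (P i).eval x := by
    refine Tx.integral_eq_sum (fun i => (P i).continuous) fun i x hx => ?_
    rw [Tv.integral_eq_sum (P := fun j v => (sliceX u.f i x j).eval v * v ^ 2)
      (fun j => (Polynomial.continuous _).mul (continuous_pow 2)) fun j v hv => by
        rw [tensorToFun_of_mem Tx Tv u.f hx hv, sq_abs, sliceX, eval_map_evalRingHom],
      sum_integral_mul_sq hk (natDegree_sliceX_le u.f_mem i x), hPeval]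
    simp only [sliceX, eval_map_evalRingHom]
  have hfield : ∫ x in (0)..L, |Tx.toFun u.E x| ^ 2
      = ∑ i, ∫ x in Tx.left i..Tx.right i, (u.E i ^ 2).eval x := by
    refine Tx.integral_eq_sum (fun i => Polynomial.continuous _) fun i x hx => ?_
    rw [Tx.toFun_of_mem _ hx, sq_abs, eval_pow]
  have hEdeg : ∀ i, (u.E i ^ 2).natDegree ≤ 2 * k + 1 := fun i => by
    have := Tx.natDegree_le_of_mem_polySpace u.E_mem i
    refine natDegree_pow_le.trans ?_
    omega
  rw [totalEnergy, hkin, hfield, ← mul_assoc, mul_one_div_cancel two_ne_zero, one_mul,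
    ← Finset.sum_add_distrib]
  refine Finset.sum_congr rfl fun i _ => ?_
  rw [Tx.integral_eq_sum_weight i (hPdeg i), Tx.integral_eq_sum_weight i (hEdeg i),
    ← Finset.sum_add_distrib]
  refine Finset.sum_congr rfl fun l _ => ?_
  rw [hPeval, eval_pow, mul_add]

/-! ### Conservation in the two split schemes -/

/-- The periodic transport discretization conserves mass. -/
theorem sum_integral_eq_of_periodic {a b : ℝ} (T : Mesh a b) {dt : ℝ} (hdt : dt ≠ 0) (s : ℝ)
    {w₀ w₁ : Fin T.n → ℝ[X]} (F : Fin T.n → ℝ)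
    (h : ∀ φ ∈ T.polySpace k, ∀ i,
      cellForm T dt s w₀ w₁ φ i (F i) (F ((finRotate T.n).symm i)) = 0) :
    ∑ i, ∫ y in T.left i..T.right i, (w₁ i).eval y
      = ∑ i, ∫ y in T.left i..T.right i, (w₀ i).eval y := by
  have h1 : ∀ i, ((∫ y in T.left i..T.right i, (w₁ i).eval y)
      - ∫ y in T.left i..T.right i, (w₀ i).eval y) / dt
      + F i - F ((finRotate T.n).symm i) = 0 := fun i => by
    -- With test function `1` the volume term drops out. The remaining fluxes cancel in the sum over
    -- cells, where the left flux is the right flux reindexed by a cyclic permutation.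
    have := h (fun _ => 1) (T.mem_polySpace fun _ => by simp) i
    simp only [cellForm, eval_one, derivative_one, eval_zero, mul_zero, mul_one,
      intervalIntegral.integral_zero, sub_zero, intervalIntegral.integral_div] at this
    rwa [intervalIntegral.integral_sub ((Polynomial.continuous _).intervalIntegrable _ _)
      ((Polynomial.continuous _).intervalIntegrable _ _)] at this
  have h2 := Finset.sum_congr (rfl : (Finset.univ : Finset (Fin T.n)) = _) fun i _ => h1 i
  rw [Finset.sum_sub_distrib, Finset.sum_add_distrib, Equiv.sum_comp (finRotate T.n).symm F,
    add_sub_cancel_right, Finset.sum_const_zero, ← Finset.sum_div, div_eq_zero_iff,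
    Finset.sum_sub_distrib] at h2
  exact sub_eq_zero.1 (h2.resolve_right hdt)

theorem sum_boundary_eq_zero {n : ℕ} (G : Fin (n + 1) → ℝ) (h0 : G 0 = 0)
    (hn : G (Fin.last n) = 0) : ∑ j : Fin n, (G j.succ - G j.castSucc) = 0 := by
  have h1 := Fin.sum_univ_succ G
  have h2 := Fin.sum_univ_castSucc G
  rw [Finset.sum_sub_distrib]
  linarith

/-- With zero flux through the end points, the transport discretization balances kinetic energy
with the work of the force `s`. -/
theorem sum_integral_mul_sq_sub {a b : ℝ} (T : Mesh a b) (hk : 2 ≤ k) {dt : ℝ} (hdt : dt ≠ 0)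
    (s : ℝ) {w₀ w₁ : Fin T.n → ℝ[X]} (F : Fin (T.n + 1) → ℝ) (h0 : F 0 = 0)
    (hn : F (Fin.last T.n) = 0)
    (h : ∀ φ ∈ T.polySpace k, ∀ j, cellForm T dt s w₀ w₁ φ j (F j.succ) (F j.castSucc) = 0) :
    (∑ j, ∫ v in T.left j..T.right j, (w₁ j).eval v * v ^ 2)
      - ∑ j, ∫ v in T.left j..T.right j, (w₀ j).eval v * v ^ 2
      = dt * s * ((∑ j, ∫ v in T.left j..T.right j, (w₀ j).eval v * v)
        + ∑ j, ∫ v in T.left j..T.right j, (w₁ j).eval v * v) := by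
  have hsq : ∀ (w : Fin T.n → ℝ[X]) j, IntervalIntegrable (fun v => (w j).eval v * v ^ 2)
      MeasureTheory.volume (T.left j) (T.right j) := fun w j =>
    ((Polynomial.continuous _).mul (continuous_pow 2)).intervalIntegrable _ _
  have hlin : ∀ (w : Fin T.n → ℝ[X]) j, IntervalIntegrable (fun v => (w j).eval v * v)
      MeasureTheory.volume (T.left j) (T.right j) := fun w j =>
    ((Polynomial.continuous _).mul continuous_id).intervalIntegrable _ _
  have h1 : ∀ j, (∫ v in T.left j..T.right j, (w₁ j).eval v * v ^ 2)
      - (∫ v in T.left j..T.right j, (w₀ j).eval v * v ^ 2)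
      = dt * s * ((∫ v in T.left j..T.right j, (w₀ j).eval v * v)
        + ∫ v in T.left j..T.right j, (w₁ j).eval v * v)
        - dt * (F j.succ * T.node j.succ ^ 2 - F j.castSucc * T.node j.castSucc ^ 2) := fun j => by
    -- This choice of test function needs `2 ≤ k`. As `v ^ 2` is continuous across interfaces, the
    -- flux terms telescope in the sum over cells.
    have hj := h (fun _ => X ^ 2) (T.mem_polySpace fun _ => by simpa using hk) j
    have e1 : ∫ v in T.left j..T.right j, ((w₁ j).eval v - (w₀ j).eval v) / dt * v ^ 2
        = ((∫ v in T.left j..T.right j, (w₁ j).eval v * v ^ 2)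
          - (∫ v in T.left j..T.right j, (w₀ j).eval v * v ^ 2)) / dt := by
      rw [← intervalIntegral.integral_sub (hsq w₁ j) (hsq w₀ j), ← intervalIntegral.integral_div]
      congr 1
      ext v
      ring
    have e2 : ∫ v in T.left j..T.right j, s * (((w₁ j).eval v + (w₀ j).eval v) / 2) * (2 * v)
        = s * ((∫ v in T.left j..T.right j, (w₀ j).eval v * v)
          + ∫ v in T.left j..T.right j, (w₁ j).eval v * v) := by
      rw [← intervalIntegral.integral_add (hlin w₀ j) (hlin w₁ j),
        ← intervalIntegral.integral_const_mul]
      congr 1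
      ext v
      ring
    have hd : ∀ v : ℝ, (derivative (X ^ 2 : ℝ[X])).eval v = 2 * v := fun v => by
      rw [derivative_X_pow]
      norm_num
    simp only [cellForm, hd, eval_pow, eval_X] at hj
    rw [e1, e2] at hj
    simp only [Mesh.left, Mesh.right] at hj ⊢
    field_simp at hj
    linarith
  have h2 := Finset.sum_congr (rfl : (Finset.univ : Finset (Fin T.n)) = _) fun j _ => h1 j
  rw [Finset.sum_sub_distrib, Finset.sum_sub_distrib, ← Finset.mul_sum, ← Finset.mul_sum,
    sum_boundary_eq_zero (fun r => F r * T.node r ^ 2) (by simp [h0]) (by simp [hn]), mul_zero,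
    sub_zero, Finset.sum_add_distrib] at h2
  exact h2

theorem current_eq_sum (w : Fin Tv.n → ℝ[X]) :
    current Tv w = ∑ j, ∫ v in Tv.left j..Tv.right j, (w j).eval v * v :=
  Tv.integral_eq_sum (fun _ => (Polynomial.continuous _).mul continuous_id) fun j v hv => by
    rw [Tv.toFun_of_mem _ hv]

theorem SchemeA.totalEnergy_eq (hk : 1 ≤ k) {Φ : Flux} {dt : ℝ} (hdt : dt ≠ 0)
    {u u' : State Tx Tv k} (h : SchemeA Φ dt u u') : totalEnergy u' = totalEnergy u := by
  obtain ⟨g, hg, hform, hval, hE⟩ := h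
  have hmass : ∀ j m, ∑ i, ∑ l, Tx.weight k i l * (g j m i).eval (Tx.gauss k i l)
      = ∑ i, ∑ l, Tx.weight k i l *
        (u.f i j).evalEval (Tx.gauss k i l) (Tv.gauss k j m) := fun j m => by
    have h := sum_integral_eq_of_periodic Tx hdt _ _ (hform j m)
    have e1 : ∀ i, _ := fun i => Tx.integral_eq_sum_weight (k := k) i
      ((Tx.natDegree_le_of_mem_polySpace (hg j m) i).trans (by omega))
    have e2 : ∀ i, _ := fun i => Tx.integral_eq_sum_weight (k := k) i
      ((natDegree_sliceV_le u.f_mem j (Tv.gauss k j m) i).trans (by omega))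
    simp only [e1, e2] at h
    exact h
  -- Summing over `x` first isolates the conserved mass at each Gauss velocity, with a weight that
  -- depends on `v` only.
  have hswap : ∀ c : Fin Tx.n → Fin (k + 1) → Fin Tv.n → Fin (k + 1) → ℝ,
      ∑ i, ∑ l, Tx.weight k i l * ∑ j, ∑ m, Tv.weight k j m * (c i l j m * Tv.gauss k j m ^ 2)
      = ∑ j, ∑ m, Tv.weight k j m * Tv.gauss k j m ^ 2
        * ∑ i, ∑ l, Tx.weight k i l * c i l j m := fun c => by
    simp only [Finset.mul_sum, ← Finset.univ_product_univ, ← Fintype.sum_prod_type']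
    rw [Finset.sum_comm]
    refine Finset.sum_congr rfl fun p _ => Finset.sum_congr rfl fun q _ => ?_
    ring
  have key : 2 * totalEnergy u' = 2 * totalEnergy u := by
    rw [two_mul_totalEnergy hk, two_mul_totalEnergy hk, hE]
    simp only [mul_add, Finset.sum_add_distrib]
    rw [hswap fun i l j m => (u'.f i j).evalEval (Tx.gauss k i l) (Tv.gauss k j m),
      hswap fun i l j m => (u.f i j).evalEval (Tx.gauss k i l) (Tv.gauss k j m)]
    simp only [hval, hmass]
  linarith

theorem SchemeB.totalEnergy_eq (hk : 2 ≤ k) {Φ : Flux} {dt : ℝ} (hdt : dt ≠ 0)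
    {u u' : State Tx Tv k} (h : SchemeB Φ dt u u') : totalEnergy u' = totalEnergy u := by
  obtain ⟨g, e, hg, hform, hfield, hval, hE⟩ := h
  have key : 2 * totalEnergy u' = 2 * totalEnergy u := by
    rw [two_mul_totalEnergy (by omega), two_mul_totalEnergy (by omega)]
    refine Finset.sum_congr rfl fun i _ => Finset.sum_congr rfl fun l _ => ?_
    congr 1
    have hwork := sum_integral_mul_sq_sub Tv hk hdt _
      (zeroBoundaryFlux Tv Φ dt (((u.E i).eval (Tx.gauss k i l) + e i l) / 2)
        ((1 / 2 : ℝ) • (g i l + sliceX u.f i (Tx.gauss k i l))))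
      (by simp [zeroBoundaryFlux]) (by simp [zeroBoundaryFlux]) (hform i l)
    have hf := hfield i l
    simp only [current_eq_sum] at hf
    rw [div_eq_iff hdt] at hf
    rw [sum_integral_mul_sq (by omega) (Tv.natDegree_le_of_mem_polySpace (hg i l)),
      sum_integral_mul_sq (by omega) (natDegree_sliceX_le u.f_mem i _)] at hwork
    simp only [hval, hE]
    simp only [sliceX, eval_map_evalRingHom] at hwork hf
    -- The factor multiplying the Ampère law is twice the speed `s`: it turns the field increment
    -- into the increment of `E ^ 2`, and the current terms cancel the work in `hwork`.
    linear_combination hwork + (e i l + (u.E i).eval (Tx.gauss k i l)) * hf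
  linarith

/-! ### Conservation for the composed schemes -/

theorem Scheme4.totalEnergy_eq (hk : 2 ≤ k) {Φa Φb : Flux} {dt : ℝ} (hdt : dt ≠ 0)
    {u u' : State Tx Tv k} (h : Scheme4 Φa Φb dt u u') : totalEnergy u' = totalEnergy u := by
  obtain ⟨u₁, u₂, h₁, h₂, h₃⟩ := h
  have hdt' : dt / 2 ≠ 0 := div_ne_zero hdt two_ne_zero
  rw [h₃.totalEnergy_eq (by omega) hdt', h₂.totalEnergy_eq hk hdt,
    h₁.totalEnergy_eq (by omega) hdt']

/-- This crude bound makes all substeps nonzero: `β₁ > 0`, and `β₂ = 1 - 2 * β₁ < -1 / 3`. -/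
theorem two_thirds_lt_β₁ : 2 / 3 < β₁ := by
  have h1 : (0 : ℝ) < (2 : ℝ) ^ (1 / 3 : ℝ) := by positivity
  have h2 : (0 : ℝ) < (2 : ℝ) ^ (-(1 / 3) : ℝ) := by positivity
  rw [β₁]
  linarith

theorem Scheme4F.totalEnergy_eq (hk : 2 ≤ k) {Φa Φb : Flux} {dt : ℝ} (hdt : dt ≠ 0)
    {u u' : State Tx Tv k} (h : Scheme4F Φa Φb dt u u') : totalEnergy u' = totalEnergy u := by
  obtain ⟨u₁, u₂, h₁, h₂, h₃⟩ := h
  have hβ := two_thirds_lt_β₁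
  have hβ₁ : β₁ * dt ≠ 0 := mul_ne_zero (by linarith) hdt
  have hβ₂ : β₂ * dt ≠ 0 := mul_ne_zero (by rw [β₂]; linarith) hdt
  rw [h₃.totalEnergy_eq hk hβ₁, h₂.totalEnergy_eq hk hβ₂, h₁.totalEnergy_eq hk hβ₁]

end Schemes

end VlasovAmpere

theorem mainTheorem2 {k : ℕ} (hk : 2 ≤ k) {L Vc : ℝ} (hL : 0 < L) (hVc : 0 < Vc)
    (Tx : VlasovAmpere.Mesh 0 L) (Tv : VlasovAmpere.Mesh (-Vc) Vc)
    (Φa Φb : VlasovAmpere.Flux) {dt : ℝ} (hdt : 0 < dt) :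
    (∀ u u' : VlasovAmpere.State Tx Tv k,
      VlasovAmpere.Scheme4 Φa Φb dt u u' →
        VlasovAmpere.totalEnergy u' = VlasovAmpere.totalEnergy u) ∧
    (∀ u u' : VlasovAmpere.State Tx Tv k,
      VlasovAmpere.Scheme4F Φa Φb dt u u' →
        VlasovAmpere.totalEnergy u' = VlasovAmpere.totalEnergy u) :=
  ⟨fun _ _ h => h.totalEnergy_eq hk hdt.ne', fun _ _ h => h.totalEnergy_eq hk hdt.ne'⟩
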